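/- Let $g, m_{UAV}, m_{PL}, H_{xx}, H_{yy}, q_1, q_2 > 0$ and $m_{\rm tot} = m_{UAV}+m_{PL}$. For real vertical positions $z_{POI}$ (controlled output) and $z_{PL}$ (payload) put $$\alpha = z_{POI} - \tfrac{m_{PL}}{m_{\rm tot}} z_{PL},\quad b_1 = m_{PL}m_{UAV}z_{PL}^2 + H_{yy} m_{\rm tot},\quad b_2 = m_{PL}m_{UAV}z_{PL}^2 + H_{xx} m_{\rm tot},\quad \hat q_i = \tfrac{b_i}{m_{\rm tot}} q_i .$$ The linearized dynamics of the multirotor with payload, with state $(\dot p, \omega, p, \eta)$, $p=(x,y,z)$ the position of the controlled output, $\eta=(\varphi,\theta,\psi)$ the Euler angles, and with scaled input $(\hat T,\hat\tau_\varphi,\hat\tau_\theta,\hat\tau_\psi)$, are $$\ddot x = g\theta + \alpha\hat\tau_\theta,\quad \ddot y = -g\varphi-\alpha\hat\tau_\varphi,\quad \ddot z = \hat T,\quad \dot\omega = (\hat\tau_\varphi,\hat\tau_\theta,\hat\tau_\psi),\quad \dot\eta=\omega .$$ Its lateral subsystems $\dot x_i = A_i x_i + B_i u_i$, $i\in\{1,2\}$,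 have states $(x,\dot x,\theta,\omega_y)$ and $(y,\dot y,\varphi,\omega_x)$, inputs $\hat\tau_\theta$ and $\hat\tau_\varphi$, and output $y_i = Cx_i$, the first state. Let $u_i = -B_i^\top P_i x_i$ be the linear-quadratic regulator for the cost $\int_0^\infty (\hat q_i^2 y_i^2 + u_i^2)\,dt$, where $P_i$ is the positive semidefinite solution of $A_i^\top P_i + P_iA_i - P_iB_iB_i^\top P_i + \hat q_i^2 C^\top C = 0$. Let $\mathcal H_{2,i}(z_{POI},z_{PL})$ be the $\mathcal H_2$-norm of the closed loop from a disturbance $w$ added to the input to the performance output $(\hat q_i y_i, u_i)$, that is, the $L^2(0,\infty)$-norm of its impulse response. Theorem. Let $i\in\{1,2\}$. 1. For all $z_{POI}, z_{PL}\in\mathbb R$ the matrix $P_i$ exists and is unique, and the impulse response is square integrable on $(0,\infty)$. 2. For every fixed $z_{PL}\in\mathbb R$, the function $z_{POI}\mapsto \mathcal H_{2,i}(z_{POI},z_{PL})$ has a unique global minimizer, the one at which $\alpha = \alpha^* = \sqrt{2g/\hat q_i}$; its minimal value satisfies $\mathcal H_{2,i}^2 = 2\,(2g\hat q_i)^{1/4}$,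 i.e. $\mathcal H_{2,i} = \sqrt{2\,(2g\hat q_i)^{1/4}}$. 3. The function $(z_{POI},z_{PL})\mapsto\mathcal H_{2,i}(z_{POI},z_{PL})$ on $\mathbb R^2$ has a unique global minimizer, namely $z_{PL}^* = 0$ and $z_{POI}^* = \sqrt{2g/\hat q_i}$, where $\hat q_i$ is taken at $z_{PL}=0$. -/

import Mathlib

open Matrix MeasureTheory

/-! ### The linearized multirotor with a rigidly attached payload -/

/-- Physical parameters and output weights. `Hxx`, `Hyy` are the roll and pitch entries of the
(diagonal) total inertia `H_tot`; `q i` is the positive weight of the lateral output of subsystem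
`i`: index `0` is subsystem 1 (`x`-direction, pitch), index `1` is subsystem 2 (`y`-direction, roll). -/
structure UAV where
  g : ℝ
  mUAV : ℝ
  mPL : ℝ
  Hxx : ℝ
  Hyy : ℝ
  q : Fin 2 → ℝ

namespace UAV

/-- Total mass. -/
def mTot (S : UAV) : ℝ := S.mUAV + S.mPL

/-- The inertia entry relevant to subsystem `i`: pitch for `i = 0`, roll for `i = 1`. -/
def inertia (S : UAV) (i : Fin 2) : ℝ := ![S.Hyy, S.Hxx] i

/-- Signed vertical distance `α` from the total center of gravity to the output position. -/
noncomputable def alpha (S : UAV) (zPOI zPL : ℝ) : ℝ := zPOI - S.mPL / S.mTot * zPL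

/-- `b_i = m_PL m_UAV z_PL² + H_i m_tot`. -/
def b (S : UAV) (i : Fin 2) (zPL : ℝ) : ℝ :=
  S.mPL * S.mUAV * zPL ^ 2 + S.inertia i * S.mTot

/-- Scaled output weight `q̂_i = (b_i / m_tot) q_i`. -/
noncomputable def qHat (S : UAV) (i : Fin 2) (zPL : ℝ) : ℝ := S.b i zPL / S.mTot * S.q i

/-- State matrix of the linearized system; the state is
`(ẋ, ẏ, ż, ω_x, ω_y, ω_z, x, y, z, φ, θ, ψ)`, positions being those of the point of interest. -/
def linA (g : ℝ) : Matrix (Fin 12) (Fin 12) ℝ :=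
  !![0, 0, 0, 0, 0, 0, 0, 0, 0, 0, g, 0;
     0, 0, 0, 0, 0, 0, 0, 0, 0, -g, 0, 0;
     0, 0, 0, 0, 0, 0, 0, 0, 0, 0, 0, 0;
     0, 0, 0, 0, 0, 0, 0, 0, 0, 0, 0, 0;
     0, 0, 0, 0, 0, 0, 0, 0, 0, 0, 0, 0;
     0, 0, 0, 0, 0, 0, 0, 0, 0, 0, 0, 0;
     1, 0, 0, 0, 0, 0, 0, 0, 0, 0, 0, 0;
     0, 1, 0, 0, 0, 0, 0, 0, 0, 0, 0, 0;
     0, 0, 1, 0, 0, 0, 0, 0, 0, 0, 0, 0;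
     0, 0, 0, 1, 0, 0, 0, 0, 0, 0, 0, 0;
     0, 0, 0, 0, 1, 0, 0, 0, 0, 0, 0, 0;
     0, 0, 0, 0, 0, 1, 0, 0, 0, 0, 0, 0]

/-- Input matrix of the linearized system; the scaled input is `(T, τ_φ, τ_θ, τ_ψ)`. -/
def linB (α : ℝ) : Matrix (Fin 12) (Fin 4) ℝ :=
  !![0, 0, α, 0;
     0, -α, 0, 0;
     1, 0, 0, 0;
     0, 1, 0, 0;
     0, 0, 1, 0;
     0, 0, 0, 1;
     0, 0, 0, 0;
     0, 0, 0, 0;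
     0, 0, 0, 0;
     0, 0, 0, 0;
     0, 0, 0, 0;
     0, 0, 0, 0]

/-- States of the lateral subsystems: `(x, ẋ, θ, ω_y)` and `(y, ẏ, φ, ω_x)`. -/
def latState (i : Fin 2) : Fin 4 → Fin 12 := ![![6, 0, 10, 4], ![7, 1, 9, 3]] i

/-- Inputs of the lateral subsystems: `τ_θ` and `τ_φ`. -/
def latInput (i : Fin 2) : Fin 1 → Fin 4 := ![![2], ![1]] i

/-- State matrix `A_i` of lateral subsystem `i`. -/
def latA (g : ℝ) (i : Fin 2) : Matrix (Fin 4) (Fin 4) ℝ :=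
  (linA g).submatrix (latState i) (latState i)

/-- Input matrix `B_i` of lateral subsystem `i`. -/
def latB (α : ℝ) (i : Fin 2) : Matrix (Fin 4) (Fin 1) ℝ :=
  (linB α).submatrix (latState i) (latInput i)

/-- The controlled output of a lateral subsystem is the lateral position, its first state. -/
def latC : Matrix (Fin 1) (Fin 4) ℝ := !![1, 0, 0, 0]

theorem latA_zero (g : ℝ) :
    latA g 0 = !![0, 1, 0, 0; 0, 0, g, 0; 0, 0, 0, 1; 0, 0, 0, 0] := by
  ext j k; fin_cases j <;> fin_cases k <;> rfl

theorem latA_one (g : ℝ) :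
    latA g 1 = !![0, 1, 0, 0; 0, 0, -g, 0; 0, 0, 0, 1; 0, 0, 0, 0] := by
  ext j k; fin_cases j <;> fin_cases k <;> rfl

theorem latB_zero (α : ℝ) : latB α 0 = !![0; α; 0; 1] := by
  ext j k; fin_cases j <;> fin_cases k <;> rfl

theorem latB_one (α : ℝ) : latB α 1 = !![0; -α; 0; 1] := by
  ext j k; fin_cases j <;> fin_cases k <;> rfl

/-- The lateral states are not driven by states outside their own subsystem. -/
theorem linA_decoupled (g : ℝ) (i : Fin 2) (j : Fin 4) (k : Fin 12) (hk : ∀ l, latState i l ≠ k) :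
    linA g (latState i j) k = 0 := by
  fin_cases i <;> fin_cases j <;> fin_cases k <;>
    first | rfl | exact absurd rfl (hk 0) | exact absurd rfl (hk 1) |
      exact absurd rfl (hk 2) | exact absurd rfl (hk 3)

/-- The lateral states are not driven by inputs outside their own subsystem. -/
theorem linB_decoupled (α : ℝ) (i : Fin 2) (j k : Fin 4) (hk : latInput i 0 ≠ k) :
    linB α (latState i j) k = 0 := by
  fin_cases i <;> fin_cases j <;> fin_cases k <;> first | rfl | exact absurd rfl hk

end UAV

/-! ### Linear-quadratic control and the `H₂`-norm -/

section Control

variable {n m p : ℕ}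

/-- `P` is a positive semidefinite solution of the algebraic Riccati equation
`Aᵀ P + P A - P B R⁻¹ Bᵀ P + Q = 0` with `R = I`. -/
def IsPSDRiccatiSolution (A : Matrix (Fin n) (Fin n) ℝ) (B : Matrix (Fin n) (Fin m) ℝ)
    (Q P : Matrix (Fin n) (Fin n) ℝ) : Prop :=
  P.PosSemidef ∧ Aᵀ * P + P * A - P * B * Bᵀ * P + Q = 0

/-- The positive semidefinite solution of the Riccati equation (meaningful where it exists
uniquely). -/
noncomputable def riccatiSolution (A : Matrix (Fin n) (Fin n) ℝ) (B : Matrix (Fin n) (Fin m) ℝ)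
    (Q : Matrix (Fin n) (Fin n) ℝ) : Matrix (Fin n) (Fin n) ℝ :=
  Classical.epsilon (IsPSDRiccatiSolution A B Q)

/-- Impulse response `t ↦ C exp(tA) B` of `ẋ = A x + B w`, `z = C x`. -/
noncomputable def impulseResponse (A : Matrix (Fin n) (Fin n) ℝ) (B : Matrix (Fin n) (Fin m) ℝ)
    {ι : Type} (C : Matrix ι (Fin n) ℝ) (t : ℝ) : Matrix ι (Fin m) ℝ :=
  C * NormedSpace.exp (t • A) * B

/-- Squared Frobenius norm of the impulse response at time `t`. -/
noncomputable def impulseEnergy (A : Matrix (Fin n) (Fin n) ℝ) (B : Matrix (Fin n) (Fin m) ℝ)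
    {ι : Type} [Fintype ι] (C : Matrix ι (Fin n) ℝ) (t : ℝ) : ℝ :=
  ((impulseResponse A B C t)ᵀ * impulseResponse A B C t).trace

/-- The `H₂`-norm of `ẋ = A x + B w`, `z = C x`: the `L²`-norm of the impulse response on `(0, ∞)`
(meaningful where the impulse response is square integrable). -/
noncomputable def h2Norm (A : Matrix (Fin n) (Fin n) ℝ) (B : Matrix (Fin n) (Fin m) ℝ)
    {ι : Type} [Fintype ι] (C : Matrix ι (Fin n) ℝ) : ℝ :=
  Real.sqrt (∫ t in Set.Ioi (0 : ℝ), impulseEnergy A B C t)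

/-- The feedback gain `K = R⁻¹ Bᵀ P`, `R = I`, of the linear-quadratic regulator `u = -K x` for the
cost `∫ (q² |C x|² + |u|²) dt`. -/
noncomputable def lqrGain (A : Matrix (Fin n) (Fin n) ℝ) (B : Matrix (Fin n) (Fin m) ℝ)
    (C : Matrix (Fin p) (Fin n) ℝ) (q : ℝ) : Matrix (Fin m) (Fin n) ℝ :=
  Bᵀ * riccatiSolution A B (q ^ 2 • (Cᵀ * C))

/-- State matrix of the closed loop under the linear-quadratic regulator. -/
noncomputable def lqrClosedLoop (A : Matrix (Fin n) (Fin n) ℝ) (B : Matrix (Fin n) (Fin m) ℝ)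
    (C : Matrix (Fin p) (Fin n) ℝ) (q : ℝ) : Matrix (Fin n) (Fin n) ℝ :=
  A - B * lqrGain A B C q

/-- Output matrix of the performance output `z = (q C x, u)` with `u = -K x`. -/
noncomputable def lqrOutput (A : Matrix (Fin n) (Fin n) ℝ) (B : Matrix (Fin n) (Fin m) ℝ)
    (C : Matrix (Fin p) (Fin n) ℝ) (q : ℝ) : Matrix (Fin p ⊕ Fin m) (Fin n) ℝ :=
  Matrix.fromRows (q • C) (-lqrGain A B C q)

end Control

namespace UAV

/-- `P` is a positive semidefinite solution of the Riccati equation of lateral subsystem `i`. -/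
def IsLatRiccati (S : UAV) (i : Fin 2) (zPOI zPL : ℝ) (P : Matrix (Fin 4) (Fin 4) ℝ) : Prop :=
  IsPSDRiccatiSolution (latA S.g i) (latB (S.alpha zPOI zPL) i)
    (S.qHat i zPL ^ 2 • (latCᵀ * latC)) P

/-- Energy at time `t` of the impulse response, from the input disturbance to the performance
output `(q̂_i y_i, u_i)`, of the optimally controlled lateral subsystem `i`. -/
noncomputable def latEnergy (S : UAV) (i : Fin 2) (zPOI zPL t : ℝ) : ℝ :=
  let A := latA S.g i
  let B := latB (S.alpha zPOI zPL) i
  let q := S.qHat i zPL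
  impulseEnergy (lqrClosedLoop A B latC q) B (lqrOutput A B latC q) t

/-- The `H₂`-norm, from the input disturbance to the performance output `(q̂_i y_i, u_i)`, of the
optimally controlled lateral subsystem `i`. -/
noncomputable def latH2 (S : UAV) (i : Fin 2) (zPOI zPL : ℝ) : ℝ :=
  let A := latA S.g i
  let B := latB (S.alpha zPOI zPL) i
  let q := S.qHat i zPL
  h2Norm (lqrClosedLoop A B latC q) B (lqrOutput A B latC q)

end UAV

/-! Put ρ⁴ = 2g q̂ and let τ > 0 solve 2τ²q̂α = ρ²(1 + 2τ² - τ⁴). In these parameters the Riccati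
solution is rational (`latP`), and the squared norm is tr(BᵀPB) = ρ(τ + 1/τ). This is at least 2ρ,
with equality only at τ = 1, that is q̂α = ρ², or α = √(2g/q̂). For fixed payload height α is a
translate of z_POI, which gives the first minimization. Since ρ grows with q̂ and q̂ is strictly
smallest at z_PL = 0, where α = z_POI, the joint one follows.

The trace formula (`integral_impulseEnergy`) needs no stability proof: exp(tAᵀ) P exp(tA) is
decreasing, its limit X solves AᵀX + XA = 0, and `trace_eq_zero_of_lyapunov` shows that such an X is
invisible through B.

For uniqueness (`latP_unique`), the Riccati equation forces a spectral factorization of the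
closed-loop characteristic polynomial. Positivity of P selects one factor and hence the gain BᵀP
(`gain_unique`); controllability then recovers P. Subsystem 2 is subsystem 1 with the signs of y and
ẏ flipped. -/

/-! ### Lyapunov flows and the energy integral -/

section Gramian

open Filter Topology
open scoped Matrix.Norms.Operator

variable {n m : ℕ}

/-- The flow of `Z ↦ Aᵀ Z + Z A` started at `P`. -/
noncomputable def lyapunovFlow (A P : Matrix (Fin n) (Fin n) ℝ) (t : ℝ) :
    Matrix (Fin n) (Fin n) ℝ :=
  NormedSpace.exp (t • Aᵀ) * P * NormedSpace.exp (t • A)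

theorem exp_smul_transpose (A : Matrix (Fin n) (Fin n) ℝ) (t : ℝ) :
    NormedSpace.exp (t • Aᵀ) = (NormedSpace.exp (t • A))ᵀ := by
  rw [← Matrix.transpose_smul, Matrix.exp_transpose]

theorem hasDerivAt_lyapunovFlow (A P : Matrix (Fin n) (Fin n) ℝ) (t : ℝ) :
    HasDerivAt (lyapunovFlow A P) (lyapunovFlow A (Aᵀ * P + P * A) t) t := by
  have h1 := hasDerivAt_exp_smul_const (𝕂 := ℝ) Aᵀ t
  have h2 := hasDerivAt_exp_smul_const' (𝕂 := ℝ) A t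
  refine ((h1.mul_const P).mul h2).congr_deriv ?_
  simp only [lyapunovFlow]
  noncomm_ring

theorem lyapunovFlow_add (A P : Matrix (Fin n) (Fin n) ℝ) (s t : ℝ) :
    lyapunovFlow A P (t + s) = lyapunovFlow A (lyapunovFlow A P t) s := by
  have h : NormedSpace.exp ((t + s) • A) =
      NormedSpace.exp (t • A) * NormedSpace.exp (s • A) := by
    rw [add_smul]
    exact Matrix.exp_add_of_commute _ _ ((Commute.refl A).smul_left t |>.smul_right s)
  have h' : NormedSpace.exp ((t + s) • Aᵀ) =
      NormedSpace.exp (s • Aᵀ) * NormedSpace.exp (t • Aᵀ) := by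
    rw [add_comm, add_smul]
    exact Matrix.exp_add_of_commute _ _ ((Commute.refl Aᵀ).smul_left s |>.smul_right t)
  simp only [lyapunovFlow, h', h, Matrix.mul_assoc]

theorem lyapunovFlow_zero (A P : Matrix (Fin n) (Fin n) ℝ) : lyapunovFlow A P 0 = P := by
  simp [lyapunovFlow]

theorem Matrix.PosSemidef.lyapunovFlow {A P : Matrix (Fin n) (Fin n) ℝ} (hP : P.PosSemidef)
    (t : ℝ) : (lyapunovFlow A P t).PosSemidef := by
  rw [_root_.lyapunovFlow, exp_smul_transpose, ← Matrix.conjTranspose_eq_transpose_of_trivial]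
  exact hP.conjTranspose_mul_mul_same _

theorem trace_transpose_mul_mul_nonneg {P : Matrix (Fin n) (Fin n) ℝ} (hP : P.PosSemidef)
    (Z : Matrix (Fin n) (Fin m) ℝ) : 0 ≤ (Zᵀ * P * Z).trace := by
  rw [← Matrix.conjTranspose_eq_transpose_of_trivial]
  exact (hP.conjTranspose_mul_mul_same Z).trace_nonneg

theorem hasDerivAt_trace_lyapunovFlow (A P : Matrix (Fin n) (Fin n) ℝ)
    (Z : Matrix (Fin n) (Fin m) ℝ) (t : ℝ) :
    HasDerivAt (fun t => (Zᵀ * lyapunovFlow A P t * Z).trace)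
      (Zᵀ * lyapunovFlow A (Aᵀ * P + P * A) t * Z).trace t := by
  let l : Matrix (Fin n) (Fin n) ℝ →ₗ[ℝ] ℝ :=
    { toFun := fun M => (Zᵀ * M * Z).trace
      map_add' := fun M N => by simp [Matrix.mul_add, Matrix.add_mul]
      map_smul' := fun c M => by simp }
  exact (LinearMap.toContinuousLinearMap l).hasFDerivAt.comp_hasDerivAt t
    (hasDerivAt_lyapunovFlow A P t)

variable {A P Q : Matrix (Fin n) (Fin n) ℝ}

theorem lyapunovFlow_neg (t : ℝ) : lyapunovFlow A (-Q) t = -lyapunovFlow A Q t := by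
  simp [lyapunovFlow]

theorem deriv_trace_lyapunovFlow (h : Aᵀ * P + P * A + Q = 0)
    (Z : Matrix (Fin n) (Fin m) ℝ) (t : ℝ) :
    HasDerivAt (fun t => (Zᵀ * lyapunovFlow A P t * Z).trace)
      (-(Zᵀ * lyapunovFlow A Q t * Z).trace) t := by
  have := hasDerivAt_trace_lyapunovFlow A P Z t
  rw [eq_neg_of_add_eq_zero_left h, lyapunovFlow_neg] at this
  simpa using this

/-- The derivative is minus a nonnegative trace, so the function is antitone, and it is bounded
below by 0. -/
theorem tendsto_trace_lyapunovFlow (hP : P.PosSemidef) (hQ : Q.PosSemidef)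
    (h : Aᵀ * P + P * A + Q = 0) (Z : Matrix (Fin n) (Fin m) ℝ) :
    ∃ c, Tendsto (fun t => (Zᵀ * lyapunovFlow A P t * Z).trace) atTop (𝓝 c) := by
  have hanti : Antitone fun t => (Zᵀ * lyapunovFlow A P t * Z).trace :=
    antitone_of_hasDerivAt_nonpos (fun t => deriv_trace_lyapunovFlow h Z t) fun t => by
      simpa using trace_transpose_mul_mul_nonneg (hQ.lyapunovFlow t) Z
  refine ⟨_, tendsto_atTop_ciInf hanti ⟨0, ?_⟩⟩
  rintro _ ⟨t, rfl⟩
  exact trace_transpose_mul_mul_nonneg (hP.lyapunovFlow t) Z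

theorem trace_replicateCol_transpose_mul_mul (M : Matrix (Fin n) (Fin n) ℝ) (x : Fin n → ℝ) :
    ((replicateCol (Fin 1) x : Matrix (Fin n) (Fin 1) ℝ)ᵀ * M * replicateCol (Fin 1) x).trace =
      x ⬝ᵥ M *ᵥ x := by
  rw [Matrix.mul_assoc]
  simp [Matrix.trace, Matrix.mul_apply, dotProduct, Matrix.mulVec]

theorem dotProduct_mulVec_polarization {M : Matrix (Fin n) (Fin n) ℝ} (hM : Mᵀ = M)
    (j k : Fin n) :
    M j k = ((Pi.single j 1 + Pi.single k 1) ⬝ᵥ M *ᵥ (Pi.single j 1 + Pi.single k 1) -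
      (Pi.single j 1 - Pi.single k 1) ⬝ᵥ M *ᵥ (Pi.single j 1 - Pi.single k 1)) / 4 := by
  have hs : M k j = M j k := congrFun (congrFun hM j) k
  simp [Matrix.mulVec_add, Matrix.mulVec_sub, add_dotProduct, sub_dotProduct, hs]
  ring

/-- Quadratic forms of the flow converge by monotonicity, and polarization upgrades this to entries.
By the semigroup property the limit is a fixed point of the flow, so the generator annihilates it.
-/
theorem tendsto_lyapunovFlow (hP : P.PosSemidef) (hQ : Q.PosSemidef)
    (h : Aᵀ * P + P * A + Q = 0) :
    ∃ X, Xᵀ = X ∧ Aᵀ * X + X * A = 0 ∧ Tendsto (lyapunovFlow A P) atTop (𝓝 X) := by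
  have hsymm : ∀ t, (lyapunovFlow A P t)ᵀ = lyapunovFlow A P t := fun t => by
    rw [← Matrix.conjTranspose_eq_transpose_of_trivial]
    exact (hP.lyapunovFlow t).isHermitian
  have hentry : ∀ j k, ∃ c, Tendsto (fun t => lyapunovFlow A P t j k) atTop (𝓝 c) := by
    intro j k
    obtain ⟨c, hc⟩ := tendsto_trace_lyapunovFlow hP hQ h
      (replicateCol (Fin 1) (Pi.single j 1 + Pi.single k 1))
    simp only [trace_replicateCol_transpose_mul_mul] at hc
    obtain ⟨d, hd⟩ := tendsto_trace_lyapunovFlow hP hQ h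
      (replicateCol (Fin 1) (Pi.single j 1 - Pi.single k 1))
    simp only [trace_replicateCol_transpose_mul_mul] at hd
    refine ⟨(c - d) / 4, ((hc.sub hd).div_const 4).congr fun t => ?_⟩
    exact (dotProduct_mulVec_polarization (hsymm t) j k).symm
  choose X hX using hentry
  have hlim : Tendsto (lyapunovFlow A P) atTop (𝓝 (Matrix.of X)) :=
    tendsto_pi_nhds.2 fun j => tendsto_pi_nhds.2 fun k => hX j k
  refine ⟨Matrix.of X, ?_, ?_, hlim⟩
  · refine tendsto_nhds_unique ?_ hlim
    refine (((continuous_id.matrix_transpose).tendsto _).comp hlim).congr fun t => ?_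
    simp [hsymm]
  · have hinv : ∀ s, lyapunovFlow A (Matrix.of X) s = Matrix.of X := fun s => by
      have h1 : Tendsto (fun t => lyapunovFlow A P (t + s)) atTop (𝓝 (Matrix.of X)) :=
        hlim.comp (tendsto_atTop_add_const_right _ s tendsto_id)
      have h2 : Tendsto (fun t => lyapunovFlow A (lyapunovFlow A P t) s) atTop
          (𝓝 (lyapunovFlow A (Matrix.of X) s)) :=
        (tendsto_const_nhds.mul hlim).mul tendsto_const_nhds
      exact tendsto_nhds_unique (h2.congr fun t => (lyapunovFlow_add A P s t).symm) h1
    have h0 := hasDerivAt_lyapunovFlow A (Matrix.of X) 0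
    rw [lyapunovFlow_zero, funext hinv] at h0
    exact h0.unique (hasDerivAt_const 0 (Matrix.of X))

theorem impulseEnergy_eq {ι : Type} [Fintype ι] (A : Matrix (Fin n) (Fin n) ℝ)
    (B : Matrix (Fin n) (Fin m) ℝ) (E : Matrix ι (Fin n) ℝ) (t : ℝ) :
    impulseEnergy A B E t = (Bᵀ * lyapunovFlow A (Eᵀ * E) t * B).trace := by
  simp only [impulseEnergy, impulseResponse, lyapunovFlow, exp_smul_transpose,
    Matrix.transpose_mul, Matrix.mul_assoc]

/-- If `P` is an observability Gramian candidate and the homogeneous Lyapunov equation has no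
solution visible through `B`, then the impulse response is square integrable with squared norm
`tr (Bᵀ P B)`. -/
theorem integral_impulseEnergy {ι : Type} [Fintype ι] {B : Matrix (Fin n) (Fin m) ℝ}
    {E : Matrix ι (Fin n) ℝ} (hP : P.PosSemidef) (h : Aᵀ * P + P * A + Eᵀ * E = 0)
    (hX : ∀ X, Xᵀ = X → Aᵀ * X + X * A = 0 → (Bᵀ * X * B).trace = 0) :
    IntegrableOn (impulseEnergy A B E) (Set.Ioi 0) ∧
      ∫ t in Set.Ioi (0 : ℝ), impulseEnergy A B E t = (Bᵀ * P * B).trace := by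
  have hQ : (Eᵀ * E).PosSemidef := by
    rw [← Matrix.conjTranspose_eq_transpose_of_trivial]
    exact Matrix.posSemidef_conjTranspose_mul_self E
  obtain ⟨X, hXs, hXl, hlim⟩ := tendsto_lyapunovFlow hP hQ h
  have hlim' : Tendsto (fun t => (Bᵀ * lyapunovFlow A P t * B).trace) atTop (𝓝 0) := by
    rw [← hX X hXs hXl]
    have hc : Continuous fun M : Matrix (Fin n) (Fin n) ℝ => (Bᵀ * M * B).trace := by fun_prop
    exact (hc.tendsto X).comp hlim
  -- The energy is the derivative of -tr(Bᵀ P(t) B), which tends to 0; being nonnegative, it is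
  -- therefore integrable.
  have hder : ∀ t, HasDerivAt (fun t => -(Bᵀ * lyapunovFlow A P t * B).trace)
      (impulseEnergy A B E t) t := fun t => by
    rw [impulseEnergy_eq]
    exact (deriv_trace_lyapunovFlow h B t).neg.congr_deriv (neg_neg _)
  have hnn : ∀ t, 0 ≤ impulseEnergy A B E t := fun t => by
    rw [impulseEnergy_eq]
    exact trace_transpose_mul_mul_nonneg (hQ.lyapunovFlow t) B
  refine ⟨integrableOn_Ioi_deriv_of_nonneg' (fun t _ => hder t) (fun t _ => hnn t) hlim'.neg, ?_⟩
  rw [integral_Ioi_of_hasDerivAt_of_nonneg' (fun t _ => hder t) (fun t _ => hnn t) hlim'.neg]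
  simp [lyapunovFlow_zero]

end Gramian

/-! ### Explicit Riccati solution and closed-loop Lyapunov equation -/

namespace UAV

/-- The positive semidefinite Riccati solution of subsystem 1 when `2 g q = ρ ^ 4` and
`2 τ ^ 2 q α = ρ ^ 2 (1 + 2 τ ^ 2 - τ ^ 4)`. -/
noncomputable def latP (q ρ τ : ℝ) : Matrix (Fin 4) (Fin 4) ℝ :=
  !![2 * q ^ 2 * τ / ρ, 2 * q ^ 2 * τ ^ 2 / ρ ^ 2, q * ρ * τ * (τ ^ 2 - 1), q * τ ^ 2 * (τ ^ 2 - 2);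
     2 * q ^ 2 * τ ^ 2 / ρ ^ 2, 2 * q ^ 2 * τ * (τ ^ 2 + 1) / ρ ^ 3, q * τ ^ 4,
       q * (τ ^ 6 - τ ^ 4 - τ ^ 2 - 1) / (τ * ρ);
     q * ρ * τ * (τ ^ 2 - 1), q * τ ^ 4, ρ ^ 3 * (τ ^ 6 - τ ^ 4 + τ ^ 2 + 1) / (2 * τ),
       ρ ^ 2 * τ ^ 2 * (τ ^ 2 - 1) ^ 2 / 2;
     q * τ ^ 2 * (τ ^ 2 - 2), q * (τ ^ 6 - τ ^ 4 - τ ^ 2 - 1) / (τ * ρ),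
       ρ ^ 2 * τ ^ 2 * (τ ^ 2 - 1) ^ 2 / 2,
       ρ * (τ ^ 10 - 3 * τ ^ 8 + 2 * τ ^ 6 + 3 * τ ^ 2 + 1) / (2 * τ ^ 3)]

/-- Upper triangular factor of `latP`. -/
noncomputable def latPFactor (q ρ τ : ℝ) : Matrix (Fin 4) (Fin 4) ℝ :=
  !![q, q * τ / ρ, ρ ^ 2 * (τ ^ 2 - 1) / 2, ρ * τ * (τ ^ 2 - 2) / 2;
     0, q, ρ ^ 3 * τ / 2, ρ ^ 2 * (τ ^ 4 - τ ^ 2 - 1) / (2 * τ ^ 2);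
     0, 0, ρ, τ;
     0, 0, 0, 1]

theorem latP_eq (q : ℝ) {ρ τ : ℝ} (hρ : 0 < ρ) (hτ : 0 < τ) :
    latP q ρ τ = (latPFactor q ρ τ)ᵀ *
      diagonal ![2 * τ / ρ, 2 * τ / ρ ^ 3, ρ / (2 * τ), ρ / (2 * τ)] * latPFactor q ρ τ := by
  ext j k
  fin_cases j <;> fin_cases k <;>
    simp [latP, latPFactor, Matrix.mul_apply, Fin.sum_univ_four, Matrix.diagonal_apply] <;>
    field_simp <;> ring

theorem latP_posSemidef (q : ℝ) {ρ τ : ℝ} (hρ : 0 < ρ) (hτ : 0 < τ) :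
    (latP q ρ τ).PosSemidef := by
  rw [latP_eq q hρ hτ, ← Matrix.conjTranspose_eq_transpose_of_trivial]
  refine Matrix.PosSemidef.conjTranspose_mul_mul_same (Matrix.PosSemidef.diagonal ?_) _
  intro j
  fin_cases j <;> simp <;> positivity

section

variable {g α q ρ τ : ℝ}

theorem latP_isRiccati (hq : 0 < q) (hρ : 0 < ρ) (hτ : 0 < τ) (hg : 2 * g * q = ρ ^ 4)
    (hα : 2 * τ ^ 2 * (q * α) = ρ ^ 2 * (1 + 2 * τ ^ 2 - τ ^ 4)) :
    IsPSDRiccatiSolution (latA g 0) (latB α 0) (q ^ 2 • (latCᵀ * latC)) (latP q ρ τ) := by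
  have hg' : g = ρ ^ 4 / (2 * q) := by field_simp; linarith
  have hα' : α = ρ ^ 2 * (1 + 2 * τ ^ 2 - τ ^ 4) / (2 * τ ^ 2 * q) := by field_simp; linarith
  refine ⟨latP_posSemidef q hρ hτ, ?_⟩
  rw [latA_zero, latB_zero, hg', hα']
  ext j k
  fin_cases j <;> fin_cases k <;>
    simp [latP, latC, Matrix.mul_apply, Fin.sum_univ_four, Matrix.vecMul, dotProduct] <;>
    field_simp <;> ring

/-- As A has trace zero, this is also minus the trace of the closed-loop matrix. -/
theorem trace_latP (hq : 0 < q) (hρ : 0 < ρ) (hτ : 0 < τ)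
    (hα : 2 * τ ^ 2 * (q * α) = ρ ^ 2 * (1 + 2 * τ ^ 2 - τ ^ 4)) :
    ((latB α 0)ᵀ * latP q ρ τ * latB α 0).trace = ρ * (τ + 1 / τ) := by
  have hα' : α = ρ ^ 2 * (1 + 2 * τ ^ 2 - τ ^ 4) / (2 * τ ^ 2 * q) := by field_simp; linarith
  rw [latB_zero, hα']
  simp [latP, Matrix.trace, Matrix.mul_apply, Fin.sum_univ_four]
  field_simp
  ring

theorem latGain_eq (hq : 0 < q) (hρ : 0 < ρ) (hτ : 0 < τ)
    (hα : 2 * τ ^ 2 * (q * α) = ρ ^ 2 * (1 + 2 * τ ^ 2 - τ ^ 4)) :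
    (latB α 0)ᵀ * latP q ρ τ =
      !![q, 2 * q * τ / ρ, ρ ^ 2 * τ ^ 2, ρ * τ * (τ ^ 2 - 1)] := by
  have hα' : α = ρ ^ 2 * (1 + 2 * τ ^ 2 - τ ^ 4) / (2 * τ ^ 2 * q) := by field_simp; linarith
  rw [latB_zero, hα']
  ext j k
  fin_cases j; fin_cases k <;>
    simp [latP, Matrix.mul_apply, Fin.sum_univ_four] <;>
    field_simp <;> ring

/-- The homogeneous Lyapunov equation of a closed loop with gain `k` has no symmetric solution
visible through the input, provided a Hurwitz determinant does not vanish. -/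
theorem trace_eq_zero_of_lyapunov {k₁ k₂ k₃ k₄ : ℝ} (hg : g ≠ 0) (hk₁ : k₁ ≠ 0) (hk₂ : k₂ ≠ 0)
    (hdet : g * k₂ ^ 2 - (α * k₂ + k₄) * (k₂ * k₃ - k₁ * k₄) ≠ 0)
    {X : Matrix (Fin 4) (Fin 4) ℝ} (hX : Xᵀ = X)
    (h : (latA g 0 - latB α 0 * !![k₁, k₂, k₃, k₄])ᵀ * X +
      X * (latA g 0 - latB α 0 * !![k₁, k₂, k₃, k₄]) = 0) :
    ((latB α 0)ᵀ * X * latB α 0).trace = 0 := by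
  rw [latA_zero, latB_zero] at h
  rw [latB_zero]
  have hs : ∀ j k, X k j = X j k := fun j k => congrFun (congrFun hX j) k
  have e := fun j k => congrFun (congrFun h j) k
  have e00 := e 0 0
  have e02 := e 0 2
  have e11 := e 1 1
  have e13 := e 1 3
  have e22 := e 2 2
  have e33 := e 3 3
  clear e h
  simp [Matrix.mul_apply, Fin.sum_univ_four, hs 0 1, hs 0 2, hs 0 3, hs 1 2, hs 1 3, hs 2 3]
    at e00 e02 e11 e13 e22 e33
  simp [Matrix.trace, Matrix.mul_apply, Fin.sum_univ_four, hs 1 3]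
  -- The nⱼ are the entries of BᵀX, and the goal is α n₂ + n₄ = 0. Eliminating X leaves the system
  -- `hI`, `hII` in n₂ and n₄, from which the combination k₂ `hI` - k₄ `hII` produces the
  -- determinant in `hdet`.
  obtain ⟨n₂, hn₂⟩ : ∃ n, n = α * X 1 1 + X 1 3 := ⟨_, rfl⟩
  obtain ⟨n₃, hn₃⟩ : ∃ n, n = α * X 1 2 + X 2 3 := ⟨_, rfl⟩
  obtain ⟨n₄, hn₄⟩ : ∃ n, n = α * X 1 3 + X 3 3 := ⟨_, rfl⟩
  have hn₁ : α * X 0 1 + X 0 3 = 0 := by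
    have : k₁ * (α * X 0 1 + X 0 3) = 0 := by linear_combination -e00 / 2
    exact (mul_eq_zero.1 this).resolve_left hk₁
  have h01 : X 0 1 = n₂ * k₂ := by linear_combination e11 / 2 + k₂ * -hn₂
  have h02 : g * X 0 1 = n₃ * k₁ := by linear_combination e02 - k₁ * hn₃ + k₃ * hn₁
  have h22 : g * X 1 2 = n₃ * k₃ := by linear_combination e22 / 2 - k₃ * hn₃
  have h33 : X 2 3 = n₄ * k₄ := by linear_combination e33 / 2 - k₄ * hn₄
  have h13 : X 0 3 + X 1 2 = n₂ * k₄ + n₄ * k₂ := by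
    linear_combination e13 - k₄ * hn₂ - k₂ * hn₄
  have h12 : k₁ * X 1 2 = n₂ * k₂ * k₃ := by
    apply mul_left_cancel₀ hg
    linear_combination k₁ * h22 - k₃ * h02 + g * k₃ * h01
  have hI : n₂ * (g * k₂ - α * k₂ * k₃) = k₁ * (n₄ * k₄) := by
    linear_combination h02 - g * h01 + k₁ * h33 + k₁ * hn₃ + α * h12
  have hII : n₂ * (k₂ * k₃ - k₁ * (α * k₂ + k₄)) = k₁ * (n₄ * k₂) := by
    linear_combination k₁ * h13 - h12 - k₁ * hn₁ + k₁ * α * h01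
  have h2 : n₂ = 0 := by
    refine (mul_eq_zero.1 (?_ : n₂ * _ = 0)).resolve_right hdet
    linear_combination k₂ * hI - k₄ * hII
  have h4 : n₄ = 0 := by
    rw [h2] at hII
    have : k₁ * (n₄ * k₂) = 0 := by rw [← hII]; ring
    simpa [hk₁, hk₂] using this
  linear_combination α * h2 + h4 - α * hn₂ - hn₄

/-! ### Uniqueness of the Riccati solution -/

/-- Conceptually, DB = 0 and DA = -AᵀD give D AᵏB = 0 for all k, and (A, B) is controllable because
g ≠ 0. The proof checks this entrywise. -/
theorem eq_zero_of_lyapunov (hg : g ≠ 0) {D : Matrix (Fin 4) (Fin 4) ℝ} (hD : Dᵀ = D)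
    (h : (latA g 0)ᵀ * D + D * latA g 0 = 0) (hB : (latB α 0)ᵀ * D = 0) : D = 0 := by
  have hs : ∀ j k, D k j = D j k := fun j k => congrFun (congrFun hD j) k
  rw [latA_zero] at h
  rw [latB_zero] at hB
  have e := fun j k => congrFun (congrFun h j) k
  have f := fun k => congrFun (congrFun hB 0) k
  have e11 := e 1 1
  have e03 := e 0 3
  have e01 := e 0 1
  have e12 := e 1 2
  have e22 := e 2 2
  have e23 := e 2 3
  have e33 := e 3 3
  have f0 := f 0
  have f1 := f 1
  have f3 := f 3
  simp [Matrix.mul_apply, Fin.sum_univ_four, hs 0 1, hs 0 2, hs 0 3, hs 1 2, hs 1 3, hs 2 3]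
    at e11 e03 e01 e12 e22 e23 e33 f0 f1 f3
  have h01 : D 0 1 = 0 := by linarith
  have h11 : D 1 1 = 0 := by
    rw [e03, zero_add] at e12
    simpa [hg] using e12
  have h12 : D 1 2 = 0 := by
    have : g * D 1 2 = 0 := by linear_combination e22 / 2
    simpa [hg] using this
  have h03 : D 0 3 = 0 := by simpa [h01] using f0
  have h13 : D 1 3 = 0 := by simpa [h11] using f1
  have h22 : D 2 2 = 0 := by simpa [h13] using e23
  have h23 : D 2 3 = 0 := by linarith
  have h33 : D 3 3 = 0 := by simpa [h13] using f3
  ext j k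
  fin_cases j <;> fin_cases k <;> simp [*, hs 0 1, hs 0 2, hs 0 3, hs 1 2, hs 1 3, hs 2 3]

/-- The coefficients of the gain are determined by the spectral factorization identities and the
positivity conditions. -/
theorem gain_unique {k₁ k₂ k₃ k₄ : ℝ} (hq : 0 < q) (hρ : 0 < ρ) (hτ : 0 < τ)
    (hg : 2 * g * q = ρ ^ 4) (hα : 2 * τ ^ 2 * (q * α) = ρ ^ 2 * (1 + 2 * τ ^ 2 - τ ^ 4))
    (h₁ : k₁ ^ 2 = q ^ 2) (h₂ : 2 * (k₁ * k₃) = g * k₂ ^ 2)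
    (h₃ : (α * k₂ + k₄) ^ 2 = 2 * (k₃ + α * k₁))
    (h₄ : k₃ ^ 2 + α * g * k₂ ^ 2 + 2 * g * k₁ = 2 * g * k₂ * (α * k₂ + k₄))
    (hk : 0 < k₁ * k₂)
    (hminor : g * k₂ ^ 4 ≤ 4 * (k₁ * k₂ * (k₂ * k₃ - k₁ * k₄))) :
    k₁ = q ∧ k₂ = 2 * q * τ / ρ ∧ k₃ = ρ ^ 2 * τ ^ 2 ∧ k₄ = ρ * τ * (τ ^ 2 - 1) := by
  have hg0 : 0 < g := by
    have : 0 < (2 * q) * g := by nlinarith [pow_pos hρ 4]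
    exact pos_of_mul_pos_right this (by positivity)
  -- The closed loop has characteristic polynomial p(s) = s⁴ + t s³ + (k₃ + αk₁)s² + gk₂ s + gk₁;
  -- `h₁` to `h₄` are the coefficient identities of p(s)p(-s) = s⁸ + q²(g + αs²)², simplified.
  obtain ⟨t, htdef⟩ : ∃ t, t = α * k₂ + k₄ := ⟨_, rfl⟩
  rw [← htdef] at h₃ h₄
  rcases sq_eq_sq_iff_eq_or_eq_neg.1 h₁ with rfl | rfl
  · have hk₂ : 0 < k₂ := pos_of_mul_pos_right hk hq.le
    -- σ is the value of τ read off from k₂; it remains to show σ = τ.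
    obtain ⟨σ, hσ⟩ : ∃ σ, σ = k₂ * ρ / (2 * k₁) := ⟨_, rfl⟩
    have hσ0 : 0 < σ := by rw [hσ]; positivity
    have hk₂σ : k₂ = 2 * k₁ * σ / ρ := by rw [hσ]; field_simp
    have hgk : g = ρ ^ 4 / (2 * k₁) := by field_simp; linarith
    have hk₃ : k₃ = ρ ^ 2 * σ ^ 2 := by
      have : k₃ = g * k₂ ^ 2 / (2 * k₁) := by field_simp; linarith
      rw [this, hk₂σ, hgk]; field_simp
    have hαt : k₁ * α = t ^ 2 / 2 - ρ ^ 2 * σ ^ 2 := by rw [hk₃] at h₃; linarith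
    have hgk2 : g * k₂ ^ 2 = 2 * k₁ * (ρ ^ 2 * σ ^ 2) := by rw [← hk₃]; linarith
    have hgk2' : g * k₂ = ρ ^ 3 * σ := by rw [hgk, hk₂σ]; field_simp
    -- Two candidates remain, t = ρ(1 ± σ²)/σ; the minor condition `hmin'` rejects the minus sign.
    have hsq : (σ * t - ρ) ^ 2 = (ρ * σ ^ 2) ^ 2 := by
      have : ρ ^ 2 * (σ * t - ρ) ^ 2 = ρ ^ 2 * (ρ * σ ^ 2) ^ 2 := by
        rw [hk₃] at h₄
        linear_combination h₄ - α * hgk2 + 2 * t * hgk2' - hg - 2 * ρ ^ 2 * σ ^ 2 * hαt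
      exact mul_left_cancel₀ (by positivity) this
    have hmin' : 0 ≤ t ^ 2 * σ - ρ * t - ρ ^ 2 * σ ^ 3 := by
      have hk₄ : k₄ = t - α * k₂ := by linarith
      have h1 : k₁ * k₄ = k₁ * t - (t ^ 2 / 2 - ρ ^ 2 * σ ^ 2) * k₂ := by
        rw [hk₄, ← hαt]; ring
      have h2 : g * k₂ ^ 4 = 2 * k₁ * (ρ ^ 2 * σ ^ 2) * k₂ ^ 2 := by rw [← hgk2]; ring
      rw [h1, h2, hk₃] at hminor
      have h3 : 0 ≤ (4 * k₁ ^ 2 * k₂ / ρ) * (t ^ 2 * σ - ρ * t - ρ ^ 2 * σ ^ 3) := by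
        have : (4 * k₁ ^ 2 * k₂ / ρ) * (t ^ 2 * σ - ρ * t - ρ ^ 2 * σ ^ 3) =
          4 * (k₁ * k₂ * (k₂ * (ρ ^ 2 * σ ^ 2) - (k₁ * t - (t ^ 2 / 2 - ρ ^ 2 * σ ^ 2) * k₂))) -
            2 * k₁ * (ρ ^ 2 * σ ^ 2) * k₂ ^ 2 := by
          rw [hk₂σ]; field_simp; ring
        rw [this]; linarith
      exact nonneg_of_mul_nonneg_right h3 (by positivity)
    rcases sq_eq_sq_iff_eq_or_eq_neg.1 hsq with hp | hm
    · have htσ : t = ρ * (1 + σ ^ 2) / σ := by field_simp; linarith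
      have hασ : 2 * σ ^ 2 * (k₁ * α) = ρ ^ 2 * (1 + 2 * σ ^ 2 - σ ^ 4) := by
        rw [hαt, htσ]; field_simp; ring
      have hστ : σ = τ := by
        have h0 : ρ ^ 2 * (1 + σ ^ 2 * τ ^ 2) * (σ ^ 2 - τ ^ 2) = 0 := by
          linear_combination τ ^ 2 * hασ - σ ^ 2 * hα
        have h1 : σ ^ 2 - τ ^ 2 = 0 := (mul_eq_zero.1 h0).resolve_left (by positivity)
        nlinarith
      subst hστ
      refine ⟨rfl, hk₂σ, hk₃, ?_⟩
      have hk₄ : k₄ = t - (k₁ * α) * (k₂ / k₁) := by rw [htdef]; field_simp; ring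
      rw [hk₄, hαt, htσ, hk₂σ]
      field_simp; ring
    · exfalso
      have htσ : t = ρ * (1 - σ ^ 2) / σ := by field_simp; linarith
      have : t ^ 2 * σ - ρ * t - ρ ^ 2 * σ ^ 3 = -(ρ ^ 2 * σ) := by
        rw [htσ]; field_simp; ring
      rw [this] at hmin'
      have : 0 < ρ ^ 2 * σ := by positivity
      linarith
  -- Case k₁ = -q. With w = -k₃ > 0, y = wt² and r = ρ⁴, the identities give (w² + y + r)² = 4ry,
  -- although (y + r)² ≥ 4ry already.
  · exfalso
    have hk₂ : k₂ ≠ 0 := by rintro rfl; simp at hk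
    have hw : 0 < -k₃ := by
      have h0 : 0 < g * k₂ ^ 2 := by positivity
      have : 0 < q * -k₃ := by linarith
      exact pos_of_mul_pos_right this hq.le
    obtain ⟨w, hwdef⟩ : ∃ w, k₃ = -w := ⟨-k₃, by ring⟩
    subst hwdef
    rw [neg_neg] at hw
    have h5 : w ^ 2 + w * t ^ 2 + ρ ^ 4 = -(2 * g * k₂ * t) := by
      linear_combination -h₄ - α * h₂ + w * h₃ - hg
    have h6 : (w ^ 2 + w * t ^ 2 + ρ ^ 4) ^ 2 = 4 * ρ ^ 4 * (w * t ^ 2) := by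
      rw [h5]
      linear_combination -4 * g * t ^ 2 * h₂ + 4 * w * t ^ 2 * hg
    have hy : 0 ≤ w * t ^ 2 := by positivity
    have hr : 0 < ρ ^ 4 := by positivity
    have hw2 : 0 < w ^ 2 := by positivity
    nlinarith [sq_nonneg (w * t ^ 2 - ρ ^ 4), mul_nonneg hw2.le hy, mul_pos hw2 hr]

theorem latP_unique (hq : 0 < q) (hρ : 0 < ρ) (hτ : 0 < τ)
    (hg : 2 * g * q = ρ ^ 4) (hα : 2 * τ ^ 2 * (q * α) = ρ ^ 2 * (1 + 2 * τ ^ 2 - τ ^ 4))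
    {P : Matrix (Fin 4) (Fin 4) ℝ}
    (hP : IsPSDRiccatiSolution (latA g 0) (latB α 0) (q ^ 2 • (latCᵀ * latC)) P) :
    P = latP q ρ τ := by
  obtain ⟨hpsd, h⟩ := hP
  have hg0 : 0 < g := by
    have : 0 < (2 * q) * g := by nlinarith [pow_pos hρ 4]
    exact pos_of_mul_pos_right this (by positivity)
  have hsymm : Pᵀ = P := hpsd.1
  have hgain : (latB α 0)ᵀ * P = (latB α 0)ᵀ * latP q ρ τ := by
    have hs : ∀ j k, P k j = P j k := fun j k => congrFun (congrFun hsymm j) k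
    have hquad : ∀ x : Fin 4 → ℝ, 0 ≤ x ⬝ᵥ P *ᵥ x := fun x => by
      simpa using hpsd.dotProduct_mulVec_nonneg x
    rw [latA_zero, latB_zero] at h
    have e := fun j k => congrFun (congrFun h j) k
    have e00 := e 0 0
    have e01 := e 0 1
    have e02 := e 0 2
    have e03 := e 0 3
    have e11 := e 1 1
    have e12 := e 1 2
    have e13 := e 1 3
    have e22 := e 2 2
    have e33 := e 3 3
    clear e h
    simp [latC, Matrix.mul_apply, Fin.sum_univ_four, hs 0 1, hs 0 2, hs 0 3, hs 1 2, hs 1 3,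
      hs 2 3] at e00 e01 e02 e03 e11 e12 e13 e22 e33
    simp only [dotProduct, Matrix.mulVec, Fin.sum_univ_four, hs 0 1, hs 0 2, hs 0 3, hs 1 2,
      hs 1 3, hs 2 3] at hquad
    obtain ⟨k₁, hk₁⟩ : ∃ k, k = α * P 0 1 + P 0 3 := ⟨_, rfl⟩
    obtain ⟨k₂, hk₂⟩ : ∃ k, k = α * P 1 1 + P 1 3 := ⟨_, rfl⟩
    obtain ⟨k₃, hk₃⟩ : ∃ k, k = α * P 1 2 + P 2 3 := ⟨_, rfl⟩
    obtain ⟨k₄, hk₄⟩ : ∃ k, k = α * P 1 3 + P 3 3 := ⟨_, rfl⟩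
    have a00 : k₁ ^ 2 = q ^ 2 := by rw [hk₁]; linear_combination -e00
    have a01 : P 0 0 = k₁ * k₂ := by rw [hk₁, hk₂]; linear_combination e01
    have a02 : g * P 0 1 = k₁ * k₃ := by rw [hk₁, hk₃]; linear_combination e02
    have a03 : P 0 2 = k₁ * k₄ := by rw [hk₁, hk₄]; linear_combination e03
    have a11 : 2 * P 0 1 = k₂ ^ 2 := by rw [hk₂]; linear_combination e11
    have a12 : P 0 2 + g * P 1 1 = k₂ * k₃ := by rw [hk₂, hk₃]; linear_combination e12
    have a13 : P 0 3 + P 1 2 = k₂ * k₄ := by rw [hk₂, hk₄]; linear_combination e13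
    have a22 : 2 * (g * P 1 2) = k₃ ^ 2 := by rw [hk₃]; linear_combination e22
    have a33 : 2 * P 2 3 = k₄ ^ 2 := by rw [hk₄]; linear_combination e33
    clear e00 e01 e02 e03 e11 e12 e13 e22 e33
    have h00 : 0 ≤ P 0 0 := by simpa using hquad ![1, 0, 0, 0]
    have h33 : 0 ≤ P 3 3 := by simpa using hquad ![0, 0, 0, 1]
    have hk₁0 : k₁ ≠ 0 := by
      rintro rfl
      nlinarith [pow_pos hq 2]
    have hk : 0 < P 0 0 := by
      refine h00.lt_of_ne' fun h0 => ?_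
      have hk₂0 : k₂ = 0 := by simpa [hk₁0, h0] using a01
      have h01 : P 0 1 = 0 := by simpa [hk₂0] using a11
      have h03 : P 0 3 = k₁ := by simp [hk₁, h01]
      -- A zero diagonal entry with P₀₃ = k₁ ≠ 0 contradicts semidefiniteness: at this vector the
      -- form equals -P₃₃ - 2.
      have h := hquad ![-(P 3 3 + 1) / k₁, 0, 0, 1]
      simp [h0, h03] at h
      field_simp at h
      linarith
    have hminor : g * k₂ ^ 4 ≤ 4 * (k₁ * k₂ * (k₂ * k₃ - k₁ * k₄)) := by
      -- At this vector the form is P₀₀ times the leading 2×2 minor.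
      have h := hquad ![P 0 1, -P 0 0, 0, 0]
      simp at h
      have h1 : 0 ≤ P 0 0 * (P 0 0 * P 1 1 - P 0 1 ^ 2) := by linarith
      have h2 := mul_nonneg hg0.le (nonneg_of_mul_nonneg_right h1 hk)
      have h3 : g * (P 0 0 * P 1 1 - P 0 1 ^ 2) =
          k₁ * k₂ * (k₂ * k₃ - k₁ * k₄) - g * k₂ ^ 4 / 4 := by
        rw [← a03, ← a12, ← a01]
        linear_combination -g / 4 * (2 * P 0 1 + k₂ ^ 2) * a11
      linarith
    rw [a01] at hk
    obtain ⟨b₁, b₂, b₃, b₄⟩ := gain_unique (k₁ := k₁) (k₂ := k₂) (k₃ := k₃) (k₄ := k₄) hq hρ hτ hg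
      hα a00 (by linear_combination -2 * a02 + g * a11)
      (by linear_combination -α ^ 2 * a11 - 2 * α * a13 - a33 - 2 * hk₃ - 2 * α * hk₁)
      (by linear_combination -a22 + 2 * g * a13 + 2 * g * hk₁ + α * g * a11) hk hminor
    rw [latGain_eq hq hρ hτ hα, ← b₄, ← b₃, ← b₂, ← b₁, latB_zero]
    ext j k
    fin_cases j
    fin_cases k <;> simp [Matrix.mul_apply, Fin.sum_univ_four, hs 0 3, hs 1 3, hs 2 3, hs 1 2, *]
  have hQ := latP_isRiccati hq hρ hτ hg hα
  have hQsymm : (latP q ρ τ)ᵀ = latP q ρ τ := hQ.1.1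
  have hPB : ∀ M : Matrix (Fin 4) (Fin 4) ℝ, Mᵀ = M →
      M * latB α 0 * (latB α 0)ᵀ * M = ((latB α 0)ᵀ * M)ᵀ * ((latB α 0)ᵀ * M) := fun M hM => by
    simp only [Matrix.transpose_mul, Matrix.transpose_transpose, hM, Matrix.mul_assoc]
  have hQ2 := hQ.2
  -- Equal gains make the quadratic terms coincide, so the difference of the two solutions satisfies
  -- a linear Lyapunov equation.
  rw [hPB _ hsymm, hgain] at h
  rw [hPB _ hQsymm] at hQ2
  refine sub_eq_zero.1 (eq_zero_of_lyapunov (α := α) hg0.ne' ?_ ?_ ?_)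
  · rw [Matrix.transpose_sub, hsymm, hQsymm]
  · have := h.trans hQ2.symm
    rw [Matrix.mul_sub, Matrix.sub_mul, ← sub_eq_zero.2 this]
    abel
  · rw [Matrix.mul_sub, hgain, sub_self]
end

end UAV

/-! ### Norm of a linear-quadratic regulator; change of coordinates -/

section Control

variable {n m p : ℕ}

/-- The linear-quadratic regulator given by a unique Riccati solution `P` has a square integrable
impulse response with squared norm `tr (Bᵀ P B)`. -/
theorem lqr_h2Norm {A : Matrix (Fin n) (Fin n) ℝ} {B : Matrix (Fin n) (Fin m) ℝ}
    {C : Matrix (Fin p) (Fin n) ℝ} {q : ℝ} {P : Matrix (Fin n) (Fin n) ℝ}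
    (hP : IsPSDRiccatiSolution A B (q ^ 2 • (Cᵀ * C)) P)
    (huniq : ∀ P', IsPSDRiccatiSolution A B (q ^ 2 • (Cᵀ * C)) P' → P' = P)
    (hX : ∀ X, Xᵀ = X → (A - B * (Bᵀ * P))ᵀ * X + X * (A - B * (Bᵀ * P)) = 0 →
      (Bᵀ * X * B).trace = 0) :
    IntegrableOn (impulseEnergy (lqrClosedLoop A B C q) B (lqrOutput A B C q)) (Set.Ioi 0) ∧
      h2Norm (lqrClosedLoop A B C q) B (lqrOutput A B C q) = √(Bᵀ * P * B).trace := by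
  have hgain : lqrGain A B C q = Bᵀ * P := by
    rw [lqrGain, riccatiSolution, huniq _ (Classical.epsilon_spec ⟨P, hP⟩)]
  have hsymm : Pᵀ = P := hP.1.1
  -- With K = BᵀP the Riccati equation becomes the closed-loop Lyapunov equation with weight q²CᵀC +
  -- KᵀK.
  have hlyap : (A - B * (Bᵀ * P))ᵀ * P + P * (A - B * (Bᵀ * P)) +
      (fromRows (q • C) (-(Bᵀ * P)))ᵀ * fromRows (q • C) (-(Bᵀ * P)) = 0 := by
    rw [Matrix.transpose_fromRows, Matrix.fromCols_mul_fromRows, ← hP.2]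
    simp only [Matrix.transpose_sub, Matrix.transpose_mul, Matrix.transpose_transpose, hsymm,
      Matrix.transpose_smul, Matrix.transpose_neg, Matrix.sub_mul, Matrix.mul_sub,
      Matrix.mul_assoc, Matrix.neg_mul, Matrix.mul_neg, Matrix.smul_mul, Matrix.mul_smul,
      smul_smul, neg_neg, sq]
    abel
  have := integral_impulseEnergy hP.1 hlyap hX
  rw [h2Norm, lqrClosedLoop, lqrOutput, hgain]
  exact ⟨this.1, by rw [this.2]⟩

theorem isPSDRiccatiSolution_conj {A J Q P : Matrix (Fin n) (Fin n) ℝ}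
    {B : Matrix (Fin n) (Fin m) ℝ} (hJ : J * J = 1) (hJs : Jᵀ = J)
    (h : IsPSDRiccatiSolution A B Q P) :
    IsPSDRiccatiSolution (J * A * J) (J * B) (J * Q * J) (J * P * J) := by
  have hc : ∀ {k : ℕ} (M : Matrix (Fin n) (Fin k) ℝ), J * (J * M) = M := fun M => by
    rw [← Matrix.mul_assoc, hJ, Matrix.one_mul]
  refine ⟨?_, ?_⟩
  · have := h.1.conjTranspose_mul_mul_same J
    rwa [Matrix.conjTranspose_eq_transpose_of_trivial, hJs] at this
  · calc _ = J * (Aᵀ * P + P * A - P * B * Bᵀ * P + Q) * J := by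
          simp only [Matrix.transpose_mul, hJs, Matrix.mul_add, Matrix.add_mul, Matrix.mul_sub,
            Matrix.sub_mul, Matrix.mul_assoc, hc]
      _ = 0 := by rw [h.2, Matrix.mul_zero, Matrix.zero_mul]

end Control

/-! ### Both lateral subsystems -/

namespace UAV

/-- Change of coordinates between the two lateral subsystems. -/
def latSign : Fin 2 → Matrix (Fin 4) (Fin 4) ℝ :=
  ![1, diagonal ![-1, -1, 1, 1]]

theorem latSign_mul_self (i : Fin 2) : latSign i * latSign i = 1 := by
  fin_cases i
  · simp [latSign]
  · ext j k
    fin_cases j <;> fin_cases k <;> simp [latSign]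

theorem latSign_transpose (i : Fin 2) : (latSign i)ᵀ = latSign i := by
  fin_cases i <;> simp [latSign]

theorem latA_eq_conj (g : ℝ) (i : Fin 2) : latA g i = latSign i * latA g 0 * latSign i := by
  fin_cases i
  · simp [latSign]
  · ext j k
    fin_cases j <;> fin_cases k <;> simp [latSign, latA_zero, latA_one]

theorem latB_eq_conj (α : ℝ) (i : Fin 2) : latB α i = latSign i * latB α 0 := by
  fin_cases i
  · simp [latSign]
  · ext j k
    fin_cases j <;> fin_cases k <;> simp [latSign, latB_zero, latB_one]

theorem latQ_eq_conj (c : ℝ) (i : Fin 2) :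
    c • (latCᵀ * latC) = latSign i * (c • (latCᵀ * latC)) * latSign i := by
  fin_cases i
  · simp [latSign]
  · ext j k
    fin_cases j <;> fin_cases k <;> simp [latSign, latC, Matrix.mul_apply, Fin.sum_univ_four]

section

variable {g α q ρ τ : ℝ}

/-- With a = 1 - qα/ρ², the square w = τ² solves w² - 2aw - 1 = 0. The roots have product -1, so
exactly one is positive: a + √(a² + 1). -/
theorem exists_latParam (hρ : 0 < ρ) (q α : ℝ) :
    ∃ τ, 0 < τ ∧ 2 * τ ^ 2 * (q * α) = ρ ^ 2 * (1 + 2 * τ ^ 2 - τ ^ 4) := by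
  obtain ⟨a, ha⟩ : ∃ a, a = 1 - q * α / ρ ^ 2 := ⟨_, rfl⟩
  have hs : √(a ^ 2 + 1) ^ 2 = a ^ 2 + 1 := Real.sq_sqrt (by positivity)
  have hw : 0 < a + √(a ^ 2 + 1) := by
    have : |a| < √(a ^ 2 + 1) := by
      rw [← Real.sqrt_sq_eq_abs]
      exact Real.sqrt_lt_sqrt (by positivity) (by linarith)
    linarith [neg_abs_le a]
  have hτ : √(a + √(a ^ 2 + 1)) ^ 2 = a + √(a ^ 2 + 1) := Real.sq_sqrt hw.le
  refine ⟨√(a + √(a ^ 2 + 1)), Real.sqrt_pos.2 hw, ?_⟩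
  have hqα : q * α = ρ ^ 2 * (1 - a) := by rw [ha]; field_simp; ring
  rw [show √(a + √(a ^ 2 + 1)) ^ 4 = (√(a + √(a ^ 2 + 1)) ^ 2) ^ 2 by ring, hτ, hqα]
  linear_combination ρ ^ 2 * hs

/-- Well-posedness and value of the `H₂`-norm of the optimally controlled lateral subsystems. -/
theorem lat_h2Norm (hq : 0 < q) (hρ : 0 < ρ) (hτ : 0 < τ) (hg : 2 * g * q = ρ ^ 4)
    (hα : 2 * τ ^ 2 * (q * α) = ρ ^ 2 * (1 + 2 * τ ^ 2 - τ ^ 4)) (i : Fin 2) :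
    (∃! P, IsPSDRiccatiSolution (latA g i) (latB α i) (q ^ 2 • (latCᵀ * latC)) P) ∧
    IntegrableOn (impulseEnergy (lqrClosedLoop (latA g i) (latB α i) latC q) (latB α i)
      (lqrOutput (latA g i) (latB α i) latC q)) (Set.Ioi 0) ∧
    h2Norm (lqrClosedLoop (latA g i) (latB α i) latC q) (latB α i)
      (lqrOutput (latA g i) (latB α i) latC q) = √(ρ * (τ + 1 / τ)) := by
  have hJ := latSign_mul_self i
  have hJs := latSign_transpose i
  have hc : ∀ {k : ℕ} (M : Matrix (Fin 4) (Fin k) ℝ), latSign i * (latSign i * M) = M :=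
    fun M => by rw [← Matrix.mul_assoc, hJ, Matrix.one_mul]
  have hP : IsPSDRiccatiSolution (latA g i) (latB α i) (q ^ 2 • (latCᵀ * latC))
      (latSign i * latP q ρ τ * latSign i) := by
    rw [latA_eq_conj, latB_eq_conj, latQ_eq_conj _ i]
    exact isPSDRiccatiSolution_conj hJ hJs (latP_isRiccati hq hρ hτ hg hα)
  have huniq : ∀ P, IsPSDRiccatiSolution (latA g i) (latB α i) (q ^ 2 • (latCᵀ * latC)) P →
      P = latSign i * latP q ρ τ * latSign i := fun P h => by
    have h' := isPSDRiccatiSolution_conj hJ hJs h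
    rw [← latQ_eq_conj, latA_eq_conj, latB_eq_conj] at h'
    simp only [Matrix.mul_assoc, hc, hJ, Matrix.mul_one] at h'
    rw [← latP_unique hq hρ hτ hg hα h']
    simp only [Matrix.mul_assoc, hc, hJ, Matrix.mul_one]
  have hg0 : g ≠ 0 := by
    rintro rfl
    have := pow_pos hρ 4
    linarith
  have hX : ∀ X, Xᵀ = X →
      (latA g i - latB α i * ((latB α i)ᵀ * (latSign i * latP q ρ τ * latSign i)))ᵀ * X +
        X * (latA g i - latB α i * ((latB α i)ᵀ * (latSign i * latP q ρ τ * latSign i))) = 0 →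
      ((latB α i)ᵀ * X * latB α i).trace = 0 := fun X hXs h => by
    -- For the optimal gain the determinant is -qρ²(τ⁴ + 1), which never vanishes.
    have hdet : g * (2 * q * τ / ρ) ^ 2 - (α * (2 * q * τ / ρ) + ρ * τ * (τ ^ 2 - 1)) *
        (2 * q * τ / ρ * (ρ ^ 2 * τ ^ 2) - q * (ρ * τ * (τ ^ 2 - 1))) ≠ 0 := by
      have hg' : g = ρ ^ 4 / (2 * q) := by field_simp; linarith
      have hα' : α = ρ ^ 2 * (1 + 2 * τ ^ 2 - τ ^ 4) / (2 * τ ^ 2 * q) := by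
        field_simp; linarith
      have : g * (2 * q * τ / ρ) ^ 2 - (α * (2 * q * τ / ρ) + ρ * τ * (τ ^ 2 - 1)) *
          (2 * q * τ / ρ * (ρ ^ 2 * τ ^ 2) - q * (ρ * τ * (τ ^ 2 - 1))) =
          -(q * ρ ^ 2 * (τ ^ 4 + 1)) := by
        rw [hg', hα']; field_simp; ring
      rw [this, neg_ne_zero]
      positivity
    have key := trace_eq_zero_of_lyapunov (X := latSign i * X * latSign i) hg0 hq.ne'
      (by positivity) hdet
      (by simp only [Matrix.transpose_mul, hJs, hXs, Matrix.mul_assoc])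
    rw [← latGain_eq hq hρ hτ hα] at key
    rw [latB_eq_conj, Matrix.transpose_mul, hJs]
    simp only [Matrix.mul_assoc] at key ⊢
    apply key
    have h' := congrArg (fun M => latSign i * M * latSign i) h
    rw [latA_eq_conj, latB_eq_conj] at h'
    simpa only [Matrix.transpose_mul, Matrix.transpose_sub, Matrix.transpose_transpose, hJs,
      Matrix.mul_add, Matrix.add_mul, Matrix.mul_sub, Matrix.sub_mul, Matrix.mul_assoc, hc,
      hJ, Matrix.mul_one, Matrix.mul_zero, Matrix.zero_mul] using h'
  have h := lqr_h2Norm hP huniq hX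
  refine ⟨⟨_, hP, huniq⟩, h.1, ?_⟩
  rw [h.2, ← trace_latP hq hρ hτ hα, latB_eq_conj, Matrix.transpose_mul, hJs]
  simp only [Matrix.mul_assoc, hc]

theorem latParam_eq_one_iff (hρ : 0 < ρ) (hτ : 0 < τ)
    (hα : 2 * τ ^ 2 * (q * α) = ρ ^ 2 * (1 + 2 * τ ^ 2 - τ ^ 4)) : τ = 1 ↔ q * α = ρ ^ 2 := by
  constructor
  · rintro rfl
    linarith
  · intro h
    have h1 : ρ ^ 2 * (τ ^ 4 - 1) = 0 := by
      rw [h] at hα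
      linear_combination hα
    have h2 : τ ^ 4 = 1 := by
      have := (mul_eq_zero.1 h1).resolve_left (by positivity)
      linarith
    exact (pow_eq_one_iff_of_nonneg hτ.le (by norm_num)).1 h2

theorem two_lt_add_one_div (hτ : 0 < τ) (h1 : τ ≠ 1) : 2 < τ + 1 / τ := by
  have h : τ + 1 / τ - 2 = (τ - 1) ^ 2 / τ := by field_simp; ring
  have : 0 < (τ - 1) ^ 2 / τ := div_pos (sq_pos_of_ne_zero (sub_ne_zero.2 h1)) hτ
  linarith

end

/-! ### Dependence on the physical parameters -/

section

variable {S : UAV}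

theorem qHat_pos (hmUAV : 0 < S.mUAV) (hmPL : 0 < S.mPL) (hHxx : 0 < S.Hxx) (hHyy : 0 < S.Hyy)
    (hq : ∀ i, 0 < S.q i) (i : Fin 2) (zPL : ℝ) : 0 < S.qHat i zPL := by
  have hi : 0 < S.inertia i := by fin_cases i <;> simpa [inertia]
  have := hq i
  unfold qHat b mTot
  positivity

theorem qHat_lt (hmUAV : 0 < S.mUAV) (hmPL : 0 < S.mPL) (hq : ∀ i, 0 < S.q i) (i : Fin 2)
    {zPL : ℝ} (hz : zPL ≠ 0) : S.qHat i 0 < S.qHat i zPL := by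
  have := hq i
  have hm : 0 < S.mTot := by unfold mTot; positivity
  have hb : S.b i 0 < S.b i zPL := by
    have : 0 < S.mPL * S.mUAV * zPL ^ 2 := by positivity
    simp only [b]
    nlinarith
  unfold qHat
  gcongr

/-- Well-posedness of the lateral subsystems and the closed form of their `H₂`-norm. -/
theorem latH2_eq (hg : 0 < S.g) {i : Fin 2} {zPL : ℝ} (hq : 0 < S.qHat i zPL) (zPOI : ℝ) :
    (∃! P, S.IsLatRiccati i zPOI zPL P) ∧
    IntegrableOn (S.latEnergy i zPOI zPL) (Set.Ioi 0) ∧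
    ∃ τ, 0 < τ ∧ (τ = 1 ↔ S.alpha zPOI zPL = √(2 * S.g / S.qHat i zPL)) ∧
      S.latH2 i zPOI zPL = √((2 * S.g * S.qHat i zPL) ^ (1 / 4 : ℝ) * (τ + 1 / τ)) := by
  obtain ⟨ρ, hρdef⟩ : ∃ ρ, ρ = (2 * S.g * S.qHat i zPL) ^ (1 / 4 : ℝ) := ⟨_, rfl⟩
  have hρ : 0 < ρ := by rw [hρdef]; positivity
  have hρ4 : 2 * S.g * S.qHat i zPL = ρ ^ 4 := by
    rw [hρdef, ← Real.rpow_natCast, ← Real.rpow_mul (by positivity)]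
    norm_num
  obtain ⟨τ, hτ, hα⟩ := exists_latParam hρ (S.qHat i zPL) (S.alpha zPOI zPL)
  obtain ⟨h1, h2, h3⟩ := lat_h2Norm hq hρ hτ hρ4 hα i
  refine ⟨h1, h2, τ, hτ, ?_, by rw [← hρdef]; exact h3⟩
  rw [latParam_eq_one_iff hρ hτ hα]
  have hsqrt : √(2 * S.g / S.qHat i zPL) = ρ ^ 2 / S.qHat i zPL := by
    rw [Real.sqrt_eq_iff_mul_self_eq (by positivity) (by positivity)]
    field_simp
    linarith
  rw [hsqrt, eq_div_iff hq.ne', mul_comm]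

end

end UAV

/-! ### Minimization over the heights -/

theorem mainTheorem3 (S : UAV) (hg : 0 < S.g) (hmUAV : 0 < S.mUAV) (hmPL : 0 < S.mPL)
    (hHxx : 0 < S.Hxx) (hHyy : 0 < S.Hyy) (hq : ∀ i, 0 < S.q i) (i : Fin 2) :
    -- the optimal control problem and the norm are well defined for all vertical positions
    (∀ zPOI zPL : ℝ, (∃! P, S.IsLatRiccati i zPOI zPL P) ∧
      IntegrableOn (S.latEnergy i zPOI zPL) (Set.Ioi 0)) ∧
    -- for each payload height, the norm is minimal exactly at `α = √(2g / q̂_i)`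
    (∀ zPL zPOI : ℝ, S.alpha zPOI zPL = √(2 * S.g / S.qHat i zPL) →
      S.latH2 i zPOI zPL = √(2 * (2 * S.g * S.qHat i zPL) ^ (1 / 4 : ℝ)) ∧
      ∀ zPOI' : ℝ, zPOI' ≠ zPOI → S.latH2 i zPOI zPL < S.latH2 i zPOI' zPL) ∧
    -- jointly in both heights, the norm is minimal exactly at `z_PL = 0`, `z_POI = √(2g / q̂_i)`
    (∀ zPOI zPL : ℝ, (zPOI, zPL) ≠ (√(2 * S.g / S.qHat i 0), 0) →
      S.latH2 i (√(2 * S.g / S.qHat i 0)) 0 < S.latH2 i zPOI zPL) := by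
  have hqHat := UAV.qHat_pos hmUAV hmPL hHxx hHyy hq i
  have hmin : ∀ zPL zPOI : ℝ, S.alpha zPOI zPL = √(2 * S.g / S.qHat i zPL) →
      S.latH2 i zPOI zPL = √(2 * (2 * S.g * S.qHat i zPL) ^ (1 / 4 : ℝ)) := by
    intro zPL zPOI h
    obtain ⟨-, -, τ, hτ, hτ1, hH⟩ := UAV.latH2_eq hg (hqHat zPL) zPOI
    rw [hH, hτ1.2 h, mul_comm]
    norm_num
  have hlt : ∀ zPL zPOI : ℝ, S.alpha zPOI zPL ≠ √(2 * S.g / S.qHat i zPL) →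
      √(2 * (2 * S.g * S.qHat i zPL) ^ (1 / 4 : ℝ)) < S.latH2 i zPOI zPL := by
    intro zPL zPOI h
    obtain ⟨-, -, τ, hτ, hτ1, hH⟩ := UAV.latH2_eq hg (hqHat zPL) zPOI
    have hq0 := hqHat zPL
    rw [hH, mul_comm]
    refine Real.sqrt_lt_sqrt (by positivity) ?_
    exact mul_lt_mul_of_pos_left (UAV.two_lt_add_one_div hτ (mt hτ1.1 h)) (by positivity)
  refine ⟨fun zPOI zPL => ?_, fun zPL zPOI h => ⟨hmin zPL zPOI h, fun zPOI' hne => ?_⟩,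
    fun zPOI zPL hne => ?_⟩
  · have h := UAV.latH2_eq hg (hqHat zPL) zPOI
    exact ⟨h.1, h.2.1⟩
  · rw [hmin zPL zPOI h]
    refine hlt zPL zPOI' fun h' => hne ?_
    rw [← h] at h'
    simpa [UAV.alpha] using h'
  · rw [hmin 0 _ (by simp [UAV.alpha])]
    -- At z_PL = 0 strictness comes from τ ≠ 1; elsewhere the lower bound 2ρ is itself strictly
    -- larger.
    by_cases hz : zPL = 0
    · subst hz
      refine hlt 0 zPOI fun h' => hne ?_
      rw [← h']
      simp [UAV.alpha]
    · have h1 : √(2 * (2 * S.g * S.qHat i 0) ^ (1 / 4 : ℝ)) <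
          √(2 * (2 * S.g * S.qHat i zPL) ^ (1 / 4 : ℝ)) := by
        have h0 := hqHat 0
        have := UAV.qHat_lt hmUAV hmPL hq i hz
        refine Real.sqrt_lt_sqrt (by positivity) ?_
        gcongr
      by_cases h : S.alpha zPOI zPL = √(2 * S.g / S.qHat i zPL)
      · rwa [hmin zPL zPOI h]
      · exact h1.trans (hlt zPL zPOI h)
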